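/- A PD0L system $\mathcal H=\langle\Gamma,H,s\rangle$ consists of a finite alphabet $\Gamma$, a tuple $H=\langle h_0,\dots,h_{p-1}\rangle$ ($p\ge 1$) of morphisms $h_i:\Gamma^*\to\Gamma^*$, and a word $s\in\Gamma^*$ that is a prefix of $H(s)$, where $H$ also denotes the map on finite words given by $H(a_0a_1\cdots a_n)=h_{0}(a_0)\,h_{1 \bmod p}(a_1)\cdots h_{n\bmod p}(a_n)$. Each $H^i(s)$ is then a prefix of $H^{i+1}(s)$, and the (finite or infinite) word $H^\omega(s)=\lim_{i\to\infty}H^i(s)$ is called the word generated by $\mathcal H$. The system is non-erasing if $h_i(a)\neq\varepsilon$ for all $i$ and all $a\in\Gamma$. **Theorem.** The following two problems are algorithmically undecidable, even when restricted to non-erasing PD0L systems whose start word $s$ is a single letter. Given a PD0L system $\mathcal H=\langle\Gamma,H,s\rangle$ and a letter $b\in\Gamma$: 1. Does $b$ occur in $H^\omega(s)$? 2. Does $b$ occur infinitely many times in $H^\omega(s)$? -/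

import Mathlib

/-- A D0L system with periodic control (PD0L system) over the alphabet `A`: morphisms
`h₀, …, h_{p-1}` with `p ≥ 1`, each given by its values on the letters, and a start word `s`
that is a prefix of `H(s)`. Here `H(a₀ a₁ ⋯ aₙ) = u₀ u₁ ⋯ uₙ` with `uᵢ = h_{i mod p}(aᵢ)`. -/
structure PD0LSystem (A : Type) where
  /-- the number of morphisms -/
  period : ℕ
  period_pos : 0 < period
  /-- the morphisms, given on letters -/
  morph : Fin period → A → List A
  /-- the start word -/
  start : List A
  start_prefix : start <+:
    (start.mapIdx fun i a => morph ⟨i % period, Nat.mod_lt i period_pos⟩ a).flatten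

namespace PD0LSystem

open Filter

variable {A : Type} (S : PD0LSystem A)

/-- The map `H` on finite words: the letter at position `i` is rewritten by `h_{i mod p}`. -/
def map (w : List A) : List A :=
  (w.mapIdx fun i a => S.morph ⟨i % S.period, Nat.mod_lt i S.period_pos⟩ a).flatten

/-- No morphism sends a letter to the empty word. -/
def NonErasing : Prop := ∀ i a, S.morph i a ≠ []

/-- The finite word `Hⁱ(s)`. -/
def iter (i : ℕ) : List A := S.map^[i] S.start

/-- The finite or infinite word `x` is the limit of the words `Hⁱ(s)`: at each position `n`,
the `n`-th letter of `Hⁱ(s)` (`none` past the end of the word) is, for all large `i`, that of `x`.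
This is convergence in the metric `d(u, v) = 2 ^ (-n)`, where `n` is the length of the longest
common prefix of the words `u ≠ v`. -/
def IsLimit (x : Stream'.Seq A) : Prop :=
  ∀ n, ∀ᶠ i : ℕ in atTop, (S.iter i)[n]? = x.get? n

theorem map_prefix {u v : List A} (h : u <+: v) : S.map u <+: S.map v := by
  obtain ⟨t, rfl⟩ := h
  simp [map, List.mapIdx_append]

theorem iter_prefix_succ (i : ℕ) : S.iter i <+: S.iter (i + 1) := by
  induction i with
  | zero => exact S.start_prefix
  | succ i ih =>
    have := S.map_prefix ih
    simpa only [iter, Function.iterate_succ_apply'] using this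

theorem iter_prefix {i j : ℕ} (h : i ≤ j) : S.iter i <+: S.iter j := by
  induction j, h using Nat.le_induction with
  | base => exact List.prefix_rfl
  | succ j _ ih => exact ih.trans (S.iter_prefix_succ j)

theorem existsUnique_isLimit : ∃! x, S.IsLimit x := by
  classical
  have key : ∀ n : ℕ, ∃ o : Option A, ∀ᶠ i : ℕ in atTop, (S.iter i)[n]? = o := by
    intro n
    by_cases h : ∃ i, n < (S.iter i).length
    · obtain ⟨i, hi⟩ := h
      refine ⟨(S.iter i)[n]?, eventually_atTop.2 ⟨i, fun j hj => ?_⟩⟩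
      obtain ⟨t, ht⟩ := S.iter_prefix hj
      rw [← ht, List.getElem?_append_left hi]
    · push Not at h
      exact ⟨none, Eventually.of_forall fun i => List.getElem?_eq_none (h i)⟩
  choose f hf using key
  refine ⟨⟨f, ?_⟩, hf, ?_⟩
  · intro n hn
    obtain ⟨i, h1, h2⟩ := ((hf n).and (hf (n + 1))).exists
    rw [hn, List.getElem?_eq_none_iff] at h1
    rw [← h2, List.getElem?_eq_none_iff]
    omega
  · intro y hy
    ext1 n
    obtain ⟨i, h1, h2⟩ := ((hf n).and (hy n)).exists
    rw [← h2, h1]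
    rfl

/-- The PD0L word `H^ω(s) = lim Hⁱ(s)`, a finite or infinite word. -/
noncomputable def word : Stream'.Seq A := S.existsUnique_isLimit.choose

theorem word_isLimit : S.IsLimit S.word := S.existsUnique_isLimit.choose_spec.1

/-- The letter `b` occurs in `H^ω(s)`. -/
def Occurs (b : A) : Prop := ∃ n, S.word.get? n = some b

/-- The letter `b` occurs at infinitely many positions of `H^ω(s)`. -/
def OccursInfinitelyOften (b : A) : Prop := {n | S.word.get? n = some b}.Infinite

end PD0LSystem

/-- An input of the decision problems: a PD0L system over the alphabet `{0, …, k-1}` and a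
letter `b`. -/
structure PD0LInput where
  /-- the size `k` of the alphabet -/
  size : ℕ
  system : PD0LSystem (Fin size)
  letter : Fin size

/-- The input written out as finite data: the size of the alphabet, the table of the words
`hᵢ(a)`, the start word and the letter. -/
def PD0LInput.code (x : PD0LInput) : ℕ × List (List (List ℕ)) × List ℕ × ℕ :=
  (x.size,
    List.ofFn fun i => List.ofFn fun a => (x.system.morph i a).map Fin.val,
    x.system.start.map Fin.val,
    x.letter)

/-- Distinct inputs have distinct codes. -/
theorem PD0LInput.code_injective : Function.Injective PD0LInput.code := by
  rintro ⟨k, ⟨p, hp, h, s, hs⟩, b⟩ ⟨k', ⟨p', hp', h', s', hs'⟩, b'⟩ e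
  simp only [PD0LInput.code, Prod.mk.injEq] at e
  obtain ⟨rfl, e1, e2, e3⟩ := e
  have hpp : p = p' := by simpa using congrArg List.length e1
  subst hpp
  have hh : h = h' := by
    funext i a
    have := congrFun (List.ofFn_injective (congrFun (List.ofFn_injective e1) i)) a
    exact List.map_injective_iff.2 Fin.val_injective this
  have hss : s = s' := List.map_injective_iff.2 Fin.val_injective e2
  have hb : b = b' := Fin.ext e3
  subst hh hss hb
  rfl

/-- The problem "given `x ∈ I`, does `P x` hold?", where `x` is presented by `code x`, is
decidable: some partial recursive function halts with the right answer on the code of every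
`x ∈ I`. (On all other codes it may do anything.) -/
def DecidableProblem {ι α : Type} [Primcodable α] (code : ι → α) (I : Set ι) (P : ι → Prop) :
    Prop :=
  ∃ f : α →. Bool, Partrec f ∧ ∀ x ∈ I, ∃ v ∈ f (code x), (v = true ↔ P x)

/-! The halting problem is reduced to both questions. The only information a letter of a PD0L word
receives beyond itself is its position modulo the period `k`, and this is enough to transmit global
data from left to right.

If `H(s) = s u`, the word is `s` followed by blocks, each the image of the previous one at the
position where that one stands. Let a symbol `x` be written as one letter followed by padding, with
total length its weight, and let all surplus padding come in multiples of `k`. Then position modulo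
`k` is the accumulated weight, so successive blocks perform successive passes of a transducer with
state in `ℤ/k` (`Transducer.codes_block`). A symbol may be erased by the transducer although the
morphisms are non-erasing, because padding remains.

Such passes simulate a Turing machine with `k` tape symbols. Both half tapes are numbers in base
`k`, written in unary; a move divides one by `k` and multiplies the other by `k`. In the first pass
the unary letters of the number to be divided have weight 1, so each learns its index modulo `k` and
the final state is the remainder (`pass_word`). In the second pass the weights are `k`, except at
the end marker, so every letter sees that remainder: all agree on the next machine state, and every
`k`-th letter of the divided number survives (`pass_word'`). Halting creates a letter that
reproduces itself, so occurring once and occurring infinitely often are equivalent. The input of a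
fixed universal machine enters only through the images of the start letter. -/

namespace PD0LSystem

/-! ### Successive blocks of a PD0L word, and renaming of letters -/

section Basic

variable {A B : Type} (S : PD0LSystem A)

theorem word_get?_eq_some_iff {n : ℕ} {b : A} :
    S.word.get? n = some b ↔ ∃ i, (S.iter i)[n]? = some b := by
  constructor
  · intro h
    obtain ⟨i, hi⟩ := (S.word_isLimit n).exists
    exact ⟨i, hi.trans h⟩
  · rintro ⟨i, hi⟩
    obtain ⟨j, hj, hij⟩ := ((S.word_isLimit n).and (Filter.eventually_ge_atTop i)).exists
    obtain ⟨t, ht⟩ := S.iter_prefix hij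
    have hn : n < (S.iter i).length := by
      by_contra hn
      rw [List.getElem?_eq_none (not_lt.1 hn)] at hi
      cases hi
    rw [← hj, ← ht, List.getElem?_append_left hn, hi]

theorem occurs_iff {b : A} : S.Occurs b ↔ ∃ i, b ∈ S.iter i := by
  simp only [Occurs, word_get?_eq_some_iff, List.mem_iff_getElem?]
  exact exists_comm

theorem OccursInfinitelyOften.occurs {b : A} (h : S.OccursInfinitelyOften b) : S.Occurs b :=
  h.nonempty

/-- The image of the word `w` when its first letter stands at position `g`. -/
def mapAt (g : ℕ) : List A → List A
  | [] => []
  | a :: w => S.morph ⟨g % S.period, Nat.mod_lt g S.period_pos⟩ a ++ mapAt (g + 1) w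

theorem mapAt_append (g : ℕ) (u v : List A) :
    S.mapAt g (u ++ v) = S.mapAt g u ++ S.mapAt (g + u.length) v := by
  induction u generalizing g with
  | nil => simp [mapAt]
  | cons a u ih => simp [mapAt, ih, Nat.add_assoc, Nat.add_comm 1]

theorem flatten_mapIdx_eq_mapAt (g : ℕ) (w : List A) :
    (w.mapIdx fun i a => S.morph ⟨(g + i) % S.period, Nat.mod_lt _ S.period_pos⟩ a).flatten =
      S.mapAt g w := by
  induction w generalizing g with
  | nil => simp [mapAt]
  | cons a w ih => simp [mapAt, ← ih, List.mapIdx_cons, Nat.add_assoc, Nat.add_comm 1]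

theorem map_eq_mapAt (w : List A) : S.map w = S.mapAt 0 w := by
  simpa [map] using S.flatten_mapIdx_eq_mapAt 0 w

/-- The part of `Hⁱ⁺¹(s)` that follows `Hⁱ(s)`, if `H(s) = s u`. -/
def block (u : List A) : ℕ → List A
  | 0 => u
  | i + 1 => S.mapAt (S.iter i).length (block u i)

/-- `H` sends the prefix `Hⁱ(s)` to `Hⁱ⁺¹(s)`, so what is new is the image of the last block, read
from the position where that block begins. -/
theorem iter_succ_eq_append_block {u : List A} (h : S.map S.start = S.start ++ u) (i : ℕ) :
    S.iter (i + 1) = S.iter i ++ S.block u i := by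
  induction i with
  | zero => exact h
  | succ i ih =>
    have e : ∀ j, S.iter (j + 1) = S.map (S.iter j) :=
      fun j => Function.iterate_succ_apply' _ _ _
    rw [e, ih, map_eq_mapAt, mapAt_append, ← map_eq_mapAt, ← e, ih, block, Nat.zero_add]

theorem mem_iter_iff {u : List A} (h : S.map S.start = S.start ++ u) {b : A} {i : ℕ} :
    b ∈ S.iter i ↔ b ∈ S.start ∨ ∃ j < i, b ∈ S.block u j := by
  induction i with
  | zero => simp [iter]
  | succ i ih =>
    rw [iter_succ_eq_append_block S h, List.mem_append, ih, or_assoc]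
    simp only [Nat.lt_succ_iff_lt_or_eq, or_and_right, exists_or, exists_eq_left]

/-- A letter that occurs in all late blocks occurs infinitely often. -/
theorem occursInfinitelyOften_of_mem_block {u : List A} (h : S.map S.start = S.start ++ u)
    {b : A} {i₀ : ℕ} (hb : ∀ i ≥ i₀, b ∈ S.block u i) : S.OccursInfinitelyOften b := by
  have hlen : ∀ n, n ≤ (S.iter (i₀ + n)).length := by
    intro n
    induction n with
    | zero => exact Nat.zero_le _
    | succ n ih =>
      rw [← Nat.add_assoc, iter_succ_eq_append_block S h, List.length_append]
      have := List.length_pos_of_mem (hb (i₀ + n) (Nat.le_add_right _ _))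
      omega
  refine Set.infinite_of_forall_exists_gt fun n => ?_
  obtain ⟨m, hm⟩ := List.mem_iff_getElem?.1 (hb (i₀ + (n + 1)) (Nat.le_add_right _ _))
  refine ⟨(S.iter (i₀ + (n + 1))).length + m, ?_, ?_⟩
  · refine S.word_get?_eq_some_iff.2 ⟨i₀ + (n + 1) + 1, ?_⟩
    rw [iter_succ_eq_append_block S h, List.getElem?_append_right (Nat.le_add_right _ _),
      Nat.add_sub_cancel_left, hm]
  · have := hlen (n + 1)
    omega

theorem mapIdx_relabel (e : A ≃ B) (f : ℕ → A → List A) (w : List A) :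
    (w.map e).mapIdx (fun i b => (f i (e.symm b)).map e) = (w.mapIdx f).map (List.map e) :=
  List.ext_getElem? fun n => by simp [Function.comp_def]

/-- Renaming the letters of a PD0L system. -/
def relabel (e : A ≃ B) : PD0LSystem B where
  period := S.period
  period_pos := S.period_pos
  morph i b := (S.morph i (e.symm b)).map e
  start := S.start.map e
  start_prefix := by
    have := S.start_prefix.map e
    rwa [List.map_flatten, ← mapIdx_relabel] at this

theorem relabel_map (e : A ≃ B) (w : List A) : (S.relabel e).map (w.map e) = (S.map w).map e := by
  rw [map, map, List.map_flatten, ← mapIdx_relabel]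
  rfl

theorem relabel_iter (e : A ≃ B) (i : ℕ) : (S.relabel e).iter i = (S.iter i).map e := by
  induction i with
  | zero => rfl
  | succ i ih =>
    simp only [iter, Function.iterate_succ_apply'] at ih ⊢
    rw [ih, relabel_map]

theorem relabel_word_get?_eq_some_iff (e : A ≃ B) {n : ℕ} {a : A} :
    (S.relabel e).word.get? n = some (e a) ↔ S.word.get? n = some a := by
  simp [word_get?_eq_some_iff, relabel_iter]

theorem relabel_occurs_iff (e : A ≃ B) {a : A} : (S.relabel e).Occurs (e a) ↔ S.Occurs a := by
  simp only [Occurs, relabel_word_get?_eq_some_iff]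

theorem relabel_occursInfinitelyOften_iff (e : A ≃ B) {a : A} :
    (S.relabel e).OccursInfinitelyOften (e a) ↔ S.OccursInfinitelyOften a := by
  simp only [OccursInfinitelyOften, relabel_word_get?_eq_some_iff]

theorem NonErasing.relabel (e : A ≃ B) (h : S.NonErasing) : (S.relabel e).NonErasing := by
  intro i b
  simpa [PD0LSystem.relabel] using h i (e.symm b)

end Basic

end PD0LSystem

/-! ### Transducers with cyclic state, simulated by PD0L systems -/

/-- A rewriting device over the letters `X` that reads words from left to right with a state in
`ℤ/k`: reading `x` in the state `g`, it writes `out x g` and moves to the state `g + wt x`. -/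
structure Transducer (X : Type) (k : ℕ) where
  /-- the word written -/
  out : X → Fin k → List X
  /-- the amount by which the state grows -/
  wt : X → ℕ
  wt_pos : ∀ x, 0 < wt x

namespace Transducer

set_option linter.unusedSectionVars false

variable {X : Type} {k : ℕ} [NeZero k] (T : Transducer X k)

/-- The word written while reading a word from the state `g`. -/
def run (g : ℕ) : List X → List X
  | [] => []
  | x :: l => T.out x (Fin.ofNat k g) ++ run (g + T.wt x) l

/-- The change of state caused by a word. -/
def weight (l : List X) : ℕ := (l.map T.wt).sum

/-- One pass over the word, the state being kept. -/
def pass (c : List X × ℕ) : List X × ℕ := (T.run c.2 c.1, c.2 + T.weight c.1)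

theorem run_append (g : ℕ) (l m : List X) :
    T.run g (l ++ m) = T.run g l ++ T.run (g + T.weight l) m := by
  induction l generalizing g with
  | nil => simp [run, weight]
  | cons x l ih => simp [run, ih, weight, Nat.add_assoc]

theorem ofNat_congr {g g' : ℕ} (h : g ≡ g' [MOD k]) : Fin.ofNat k g = Fin.ofNat k g' :=
  Fin.ext h

theorem run_congr {g g' : ℕ} (h : g ≡ g' [MOD k]) (l : List X) : T.run g l = T.run g' l := by
  induction l generalizing g g' with
  | nil => rfl
  | cons x l ih => rw [run, run, ih (h.add_right _), ofNat_congr h]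

/-- The letters of the PD0L system simulating a transducer: `none` is the start letter,
`some none` is a padding letter. -/
abbrev Letter (X : Type) := Option (Option X)

/-- A word of padding letters. -/
def padding (X : Type) (n : ℕ) : List (Letter X) := List.replicate n (some none)

/-- The word of length `wt x` standing for the letter `x`. -/
def encodeLetter (x : X) : List (Letter X) := some (some x) :: padding X (T.wt x - 1)

/-- The word standing for a word of letters. -/
def encode (l : List X) : List (Letter X) := l.flatMap T.encodeLetter

/-- The PD0L system simulating a transducer, started with the word `l`. The state of the transducer
is the position minus one. -/
def toPD0L (l : List X) : PD0LSystem (Letter X) where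
  period := k
  period_pos := NeZero.pos k
  morph i
    | none => none :: T.encode l
    | some none => padding X k
    -- Adding `k - 1` subtracts 1 modulo `k`: the start letter occupies position 0, so the state 0
    -- belongs to position 1.
    | some (some x) => T.encode (T.out x (Fin.ofNat k (i + (k - 1)))) ++ padding X k
  start := [none]
  start_prefix := by simp

variable (l : List X)

theorem toPD0L_nonErasing : (T.toPD0L l).NonErasing := by
  have hk : padding X k ≠ [] := by simp [padding, NeZero.ne k]
  rintro i (_ | _ | x) <;> simp [toPD0L, hk]

theorem toPD0L_map_start :
    (T.toPD0L l).map (T.toPD0L l).start = (T.toPD0L l).start ++ T.encode l := by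
  simp [PD0LSystem.map, toPD0L]

/-- The word `u` consists of the words standing for the letters of a word, and of some padding that
does not change the state. -/
inductive Codes : List X → List (Letter X) → Prop
  | nil : Codes [] []
  | pad {l u} : Codes l u → Codes l (padding X k ++ u)
  | cons {l u} (x : X) : Codes l u → Codes (x :: l) (T.encodeLetter x ++ u)

variable {T}

theorem Codes.append {l m : List X} {u v : List (Letter X)} (h : T.Codes l u) (h' : T.Codes m v) :
    T.Codes (l ++ m) (u ++ v) := by
  induction h with
  | nil => exact h'
  | pad _ ih => rw [List.append_assoc]; exact ih.pad
  | cons x _ ih => rw [List.append_assoc]; exact ih.cons x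

theorem codes_encode (l : List X) : T.Codes l (T.encode l) := by
  induction l with
  | nil => exact .nil
  | cons x l ih => exact ih.cons x

theorem codes_padding (n : ℕ) : T.Codes [] (padding X (n * k)) := by
  induction n with
  | zero => rw [Nat.zero_mul]; exact .nil
  | succ n ih =>
    rw [Nat.succ_mul, Nat.add_comm, padding, List.replicate_add]
    exact ih.pad

theorem length_padding (n : ℕ) : (padding X n).length = n := List.length_replicate

theorem length_encodeLetter (x : X) : (T.encodeLetter x).length = T.wt x := by
  have := T.wt_pos x
  simp only [encodeLetter, List.length_cons, length_padding]
  omega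

/-- This is what lets positions play the role of states: free padding has length `k`, and the code
of a symbol is as long as its weight. -/
theorem Codes.length_modEq {l : List X} {u : List (Letter X)} (h : T.Codes l u) :
    u.length ≡ T.weight l [MOD k] := by
  induction h with
  | nil => rfl
  | pad _ ih =>
    rw [List.length_append, length_padding]
    simpa [Nat.ModEq] using ih
  | cons x _ ih =>
    rw [List.length_append, length_encodeLetter]
    exact ih.add_left _

theorem Codes.mem_iff {l : List X} {u : List (Letter X)} (h : T.Codes l u) {x : X} :
    some (some x) ∈ u ↔ x ∈ l := by
  induction h with
  | nil => simp
  | pad _ ih => simp [padding, ih]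
  | cons y _ ih => simp [padding, encodeLetter, ih]

theorem mapAt_padding (g n : ℕ) : (T.toPD0L l).mapAt g (padding X n) = padding X (n * k) := by
  induction n generalizing g with
  | zero => simp [padding, PD0LSystem.mapAt]
  | succ n ih =>
    rw [Nat.succ_mul, Nat.add_comm (n * k)]
    exact (congrArg (padding X k ++ ·) (ih (g + 1))).trans List.replicate_append_replicate

theorem mapAt_encodeLetter (g : ℕ) (x : X) :
    (T.toPD0L l).mapAt (g + 1) (T.encodeLetter x) =
      T.encode (T.out x (Fin.ofNat k g)) ++ padding X k ++ padding X ((T.wt x - 1) * k) := by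
  rw [encodeLetter, PD0LSystem.mapAt, mapAt_padding]
  have : Fin.ofNat k ((g + 1) % k + (k - 1)) = Fin.ofNat k g := by
    apply ofNat_congr
    have hk := NeZero.pos k
    have h1 : (g + 1) % k + (k - 1) ≡ g + 1 + (k - 1) [MOD k] :=
      (Nat.mod_modEq _ _).add_right _
    rw [show g + 1 + (k - 1) = g + k by omega] at h1
    exact h1.trans (by simp [Nat.ModEq])
  simp only [toPD0L, this]

/-- A padding letter becomes `k` padding letters wherever it stands, so padding contributes a
multiple of `k` and later symbols are read in the right state. -/
theorem Codes.mapAt {m : List X} {u : List (Letter X)} (h : T.Codes m u) {g p : ℕ}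
    (hp : p ≡ g + 1 [MOD k]) : T.Codes (T.run g m) ((T.toPD0L l).mapAt p u) := by
  have hcongr : ∀ {p p' : ℕ} (u : List (Letter X)), p ≡ p' [MOD k] →
      (T.toPD0L l).mapAt p u = (T.toPD0L l).mapAt p' u := by
    intro p p' u hp
    induction u generalizing p p' with
    | nil => rfl
    | cons a u ih =>
      have : p % (T.toPD0L l).period = p' % (T.toPD0L l).period := hp
      simp only [PD0LSystem.mapAt, this, ih (hp.add_right 1)]
  rw [hcongr u hp]
  clear hp
  induction h generalizing g with
  | nil => exact .nil
  | pad _ ih =>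
    rw [PD0LSystem.mapAt_append, mapAt_padding, length_padding,
      hcongr (p' := g + 1) _ (by simp [Nat.ModEq])]
    exact (codes_padding k).append ih
  | cons x _ ih =>
    rw [PD0LSystem.mapAt_append, mapAt_encodeLetter, length_encodeLetter, Nat.add_right_comm, run,
      List.append_assoc, List.append_assoc]
    have hpad := (codes_padding (T := T) 1).append (codes_padding (T.wt x - 1))
    rw [Nat.one_mul] at hpad
    exact (codes_encode _).append (by simpa using hpad.append (ih (g := g + T.wt x)))

theorem codes_block (i : ℕ) :
    T.Codes (T.pass^[i] (l, 0)).1 ((T.toPD0L l).block (T.encode l) i) ∧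
      ((T.toPD0L l).iter i).length ≡ (T.pass^[i] (l, 0)).2 + 1 [MOD k] := by
  induction i with
  | zero => exact ⟨codes_encode l, by rfl⟩
  | succ i ih =>
    rw [Function.iterate_succ_apply']
    refine ⟨ih.1.mapAt l ih.2, ?_⟩
    rw [PD0LSystem.iter_succ_eq_append_block _ (T.toPD0L_map_start l), List.length_append]
    exact (ih.2.add ih.1.length_modEq).trans (by simp only [pass]; rw [Nat.add_right_comm])

theorem toPD0L_occurs_iff {b : X} :
    (T.toPD0L l).Occurs (some (some b)) ↔ ∃ i, b ∈ (T.pass^[i] (l, 0)).1 := by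
  have hs : some (some b) ∉ (T.toPD0L l).start := by simp [toPD0L]
  simp only [PD0LSystem.occurs_iff, PD0LSystem.mem_iter_iff _ (T.toPD0L_map_start l), hs,
    false_or, (codes_block l _).1.mem_iff]
  exact ⟨fun ⟨_, j, _, h⟩ => ⟨j, h⟩, fun ⟨j, h⟩ => ⟨j + 1, j, Nat.lt_succ_self j, h⟩⟩

theorem mem_run {b : X} (hb : ∀ g, b ∈ T.out b g) {m : List X} (h : b ∈ m) (g : ℕ) :
    b ∈ T.run g m := by
  induction m generalizing g with
  | nil => cases h
  | cons x m ih =>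
    rcases List.mem_cons.1 h with rfl | h
    · exact List.mem_append_left _ (hb _)
    · exact List.mem_append_right _ (ih h _)

/-- A symbol that always reproduces itself persists in every later block once it has appeared. -/
theorem toPD0L_occursInfinitelyOften_iff {b : X} (hb : ∀ g, b ∈ T.out b g) :
    (T.toPD0L l).OccursInfinitelyOften (some (some b)) ↔ ∃ i, b ∈ (T.pass^[i] (l, 0)).1 := by
  refine ⟨fun h => (toPD0L_occurs_iff l).1 h.occurs, fun ⟨i₀, h⟩ => ?_⟩
  refine PD0LSystem.occursInfinitelyOften_of_mem_block _ (T.toPD0L_map_start l) (i₀ := i₀)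
    fun i hi => (codes_block l i).1.mem_iff.2 ?_
  induction i, hi using Nat.le_induction with
  | base => exact h
  | succ i _ ih =>
    rw [Function.iterate_succ_apply']
    exact mem_run hb ih _

end Transducer

/-! ### Runs over repeated letters and over letters of weight `k` -/

namespace Transducer

set_option linter.unusedSectionVars false

section Lemmas

variable {X : Type} {k : ℕ} [NeZero k] (T : Transducer X k)

theorem weight_replicate (n : ℕ) (x : X) : T.weight (List.replicate n x) = n * T.wt x := by
  simp [weight]

theorem weight_append (l m : List X) : T.weight (l ++ m) = T.weight l + T.weight m := by
  simp [weight]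

theorem weight_nil : T.weight [] = 0 := rfl

theorem weight_cons (x : X) (l : List X) : T.weight (x :: l) = T.wt x + T.weight l := rfl

theorem run_replicate (g n : ℕ) (x : X) : T.run g (List.replicate n x) =
    (List.range n).flatMap fun i => T.out x (Fin.ofNat k (g + i * T.wt x)) := by
  induction n with
  | zero => rfl
  | succ n ih =>
    rw [List.replicate_succ', run_append, ih, List.range_succ, List.flatMap_append,
      weight_replicate]
    simp [run]

theorem run_eq_flatMap {l : List X} (h : ∀ x ∈ l, T.wt x = k) (g : ℕ) :
    T.run g l = l.flatMap fun x => T.out x (Fin.ofNat k g) := by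
  induction l generalizing g with
  | nil => rfl
  | cons x l ih =>
    have hg : g + T.wt x ≡ g [MOD k] := by simp [h x List.mem_cons_self, Nat.ModEq]
    rw [run, T.run_congr hg, ih fun y hy => h y (List.mem_cons_of_mem _ hy), List.flatMap_cons]

theorem weight_eq_length_mul {l : List X} (h : ∀ x ∈ l, T.wt x = k) :
    T.weight l = l.length * k := by
  rw [weight, List.map_congr_left (g := fun _ => k) h]
  simp

end Lemmas

end Transducer

/-! ### Machines with two numbers, simulated in two passes per step -/

open Turing (Dir)

/-- A machine that keeps two numbers, one for each direction. In a state `q` with `dir q = some d`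
it divides the number on the side `d` by `k`, reads the remainder, and appends the digit `digit q`
to the base `k` expansion of the other number; if `dir q = none`, both numbers are kept. -/
structure NumMachine (Q : Type) (k : ℕ) where
  dir : Q → Option Dir
  digit : Q → ℕ
  /-- the next state, given the remainder; `none` to halt -/
  next : Q → Fin k → Option Q

namespace NumMachine

set_option linter.unusedSectionVars false

/-- The new value of the number on the side `d`. -/
def update (k : ℕ) (o : Option Dir) (d : Dir) (c n : ℕ) : ℕ :=
  match o with
  | none => n
  | some d' => if d' = d then n / k else k * n + c

variable {Q : Type} {k : ℕ} [NeZero k] (N : NumMachine Q k)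

/-- The number that is divided. -/
def readNum (q : Q) (L R : ℕ) : ℕ :=
  match N.dir q with
  | none => 0
  | some .left => L
  | some .right => R

/-- One step of the machine. -/
def step (c : Q × ℕ × ℕ) : Option (Q × ℕ × ℕ) :=
  (N.next c.1 (Fin.ofNat k (N.readNum c.1 c.2.1 c.2.2))).map fun q =>
    (q, update k (N.dir c.1) .left (N.digit c.1) c.2.1,
      update k (N.dir c.1) .right (N.digit c.1) c.2.2)

/-- The letters of the transducer that simulates a machine. A number `n` is written in unary with
the letters `num`; the primed letters are used in the second pass of the simulation of a step. -/
inductive Sym (Q : Type) (k : ℕ)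
  | front (q : Q)
  | num (d : Dir) (q : Q)
  | back (q : Q)
  | front' (q : Q)
  | num' (d : Dir) (q : Q) (j : Fin k)
  | back' (q : Q) (r : Fin k)
  | halted

open NumMachine.Sym

/-- What becomes of a letter for the number on the side `d` that has the index `j` modulo `k`. -/
def numImage (o : Option Dir) (d : Dir) (j : Fin k) (x : Sym Q k) : List (Sym Q k) :=
  match o with
  | none => [x]
  -- Indices start at 0, so the survivor is the last letter of each complete group of `k`.
  | some d' => if d' = d then if j.1 + 1 = k then [x] else [] else List.replicate k x

/-- The transducer that simulates a machine, in two passes for each step. -/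
def toTransducer : Transducer (Sym Q k) k where
  out
    | front q, _ => [front' q]
    | num d q, g => [num' d q g]
    | back q, g => [back' q g]
    | front' q, g => (N.next q g).elim [] fun q' => front q' ::
        if N.dir q = some .right then List.replicate (N.digit q) (num .left q') else []
    | num' d q j, g => (N.next q g).elim [] fun q' => numImage (N.dir q) d j (num d q')
    | back' q _, g => (N.next q g).elim [halted] fun q' =>
        (if N.dir q = some .left then List.replicate (N.digit q) (num .right q') else []) ++
          [back q']
    | halted, _ => [halted]
  wt
    | num d q => if N.dir q = some d then 1 else k
    -- The second pass starts in the state `r`; this weight returns it to 0 for the next step.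
    | back' _ r => k - r
    | _ => k
  wt_pos x := by
    have := NeZero.pos k
    rcases x with q | ⟨d, q⟩ | q | q | q | ⟨q, r⟩ | _
    case num => dsimp only; split_ifs <;> omega
    all_goals dsimp only; omega

/-- The word for a configuration of the machine. -/
def word (c : Q × ℕ × ℕ) : List (Sym Q k) :=
  front c.1 :: (List.replicate c.2.1 (num .left c.1) ++
    (List.replicate c.2.2 (num .right c.1) ++ [back c.1]))

theorem halted_notMem_word (c : Q × ℕ × ℕ) : halted ∉ word (k := k) c := by
  simp [word]

/-- The quotient `n / k` grows exactly when `k` divides `n + 1`. The appended digit is 0 here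
because the end markers supply the actual one. -/
theorem flatMap_numImage (o : Option Dir) (d : Dir) (x : Sym Q k) (n : ℕ) (t : ℕ → Fin k)
    (ht : o = some d → ∀ i, (t i : ℕ) = i % k) :
    (List.range n).flatMap (fun i => numImage o d (t i) x) =
      List.replicate (update k o d 0 n) x := by
  rcases o with _ | d'
  · simp [numImage, update, List.eq_replicate_iff]
  by_cases h : d' = d
  · have hk := NeZero.pos k
    have hd : ∀ i, i % k + 1 = k ↔ k ∣ i + 1 := by
      intro i
      have := Nat.mod_lt i hk
      have e : i + 1 = k * (i / k) + (i % k + 1) := by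
        have := Nat.mod_add_div i k
        omega
      have e' : k ∣ i + 1 ↔ k ∣ i % k + 1 := by
        conv_lhs => rw [e]
        exact Nat.dvd_add_right (Nat.dvd_mul_right _ _)
      rw [e']
      exact ⟨fun h => dvd_of_eq h.symm, fun h => le_antisymm this (Nat.le_of_dvd (Nat.succ_pos _) h)⟩
    induction n with
    | zero => simp [update, h]
    | succ n ih =>
      rw [List.range_succ, List.flatMap_append, ih]
      simp only [update, h, if_true, numImage, List.flatMap_singleton, ht (congrArg some h), hd,
        Nat.succ_div]
      split_ifs
      · rw [List.replicate_succ']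
      · simp
  · simp only [numImage, update, h, if_false]
    induction n with
    | zero => simp
    | succ n ih =>
      rw [List.range_succ, List.flatMap_append, ih]
      simp [List.replicate_append_replicate, Nat.mul_succ]

/-- The word after the first pass. -/
def word' (c : Q × ℕ × ℕ) : List (Sym Q k) :=
  front' c.1 :: ((List.range c.2.1).map (fun i => num' .left c.1 (Fin.ofNat k
      (i * N.toTransducer.wt (num .left c.1)))) ++
    ((List.range c.2.2).map (fun i => num' .right c.1 (Fin.ofNat k
      (c.2.1 * N.toTransducer.wt (num .left c.1) + i * N.toTransducer.wt (num .right c.1)))) ++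
    [back' c.1 (Fin.ofNat k (N.readNum c.1 c.2.1 c.2.2))]))

theorem weight_word_modEq (c : Q × ℕ × ℕ) :
    c.2.1 * N.toTransducer.wt (num .left c.1) + c.2.2 * N.toTransducer.wt (num .right c.1) ≡
      N.readNum c.1 c.2.1 c.2.2 [MOD k] := by
  rcases h : N.dir c.1 with _ | _ | _ <;> simp [toTransducer, readNum, h, Nat.ModEq]

theorem pass_word (c : Q × ℕ × ℕ) {g : ℕ} (hg : g ≡ 0 [MOD k]) :
    (N.toTransducer.pass (word c, g)).1 = N.word' c ∧
      (N.toTransducer.pass (word c, g)).2 ≡ N.readNum c.1 c.2.1 c.2.2 [MOD k] := by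
  have hw := N.weight_word_modEq c
  have hf : N.toTransducer.wt (front c.1) = k := rfl
  have hb : N.toTransducer.wt (back c.1) = k := rfl
  have hgk : g + k ≡ 0 [MOD k] := by simpa [Nat.ModEq] using hg
  constructor
  · have e1 : ∀ m, Fin.ofNat k (g + k + m) = Fin.ofNat k m := fun m =>
      Transducer.ofNat_congr (by simpa using hgk.add_right m)
    have e2 := Transducer.ofNat_congr hw
    simp only [Transducer.pass, word, word', Transducer.run, Transducer.run_append,
      Transducer.run_replicate, Transducer.weight_replicate, hf, Nat.add_assoc (g + k), e1, e2]
    simp only [toTransducer, ← List.map_eq_flatMap, List.singleton_append, List.append_nil]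
  · simp only [Transducer.pass, word, Transducer.weight_cons, Transducer.weight_append,
      Transducer.weight_replicate, hf, hb, Transducer.weight_nil]
    have := (hg.add hw).add_right (k + k)
    rw [Nat.zero_add] at this
    refine Nat.ModEq.trans (by rw [Nat.ModEq]; congr 1; ring) (this.trans ?_)
    simp [Nat.ModEq, ← Nat.add_assoc]

theorem weight_word' (c : Q × ℕ × ℕ) :
    N.toTransducer.weight (N.word' c) + (Fin.ofNat k (N.readNum c.1 c.2.1 c.2.2) : ℕ) ≡
      0 [MOD k] := by
  set r := Fin.ofNat k (N.readNum c.1 c.2.1 c.2.2)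
  rw [word', Transducer.weight_cons, Transducer.weight_append, Transducer.weight_append,
    N.toTransducer.weight_eq_length_mul, N.toTransducer.weight_eq_length_mul]
  · have : N.toTransducer.weight [back' c.1 r] + r = k := by
      have := r.2
      simp only [Transducer.weight, toTransducer, List.map_cons, List.map_nil, List.sum_cons,
        List.sum_nil]
      omega
    rw [Nat.add_assoc, Nat.add_assoc, Nat.add_assoc, this]
    simp [toTransducer, Nat.ModEq]
  all_goals
    intro x hx
    obtain ⟨_, _, rfl⟩ := List.mem_map.1 hx
    rfl

/-- All letters before the last have weight `k`, so the whole word is read in one state, the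
remainder found by the first pass. -/
theorem pass_word' (c : Q × ℕ × ℕ) {g : ℕ} (hg : g ≡ N.readNum c.1 c.2.1 c.2.2 [MOD k]) :
    (∀ c', N.step c = some c' → (N.toTransducer.pass (N.word' c, g)).1 = word c') ∧
    (N.step c = none → halted ∈ (N.toTransducer.pass (N.word' c, g)).1) ∧
    (N.toTransducer.pass (N.word' c, g)).2 ≡ 0 [MOD k] := by
  have hrun : N.toTransducer.run g (N.word' c) = (N.word' c).flatMap fun x =>
      N.toTransducer.out x (Fin.ofNat k (N.readNum c.1 c.2.1 c.2.2)) := by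
    rw [N.toTransducer.run_congr hg, word']
    simp only [← List.append_assoc]
    have h : ∀ x ∈ front' c.1 :: ((List.range c.2.1).map (fun i => num' .left c.1 (Fin.ofNat k
      (i * N.toTransducer.wt (num .left c.1)))) ++
    (List.range c.2.2).map (fun i => num' .right c.1 (Fin.ofNat k
      (c.2.1 * N.toTransducer.wt (num .left c.1) + i * N.toTransducer.wt (num .right c.1))))),
      N.toTransducer.wt x = k := by
      intro x hx
      simp only [List.mem_cons, List.mem_append, List.mem_map] at hx
      rcases hx with rfl | ⟨_, _, rfl⟩ | ⟨_, _, rfl⟩ <;> rfl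
    rw [← List.cons_append, Transducer.run_append, N.toTransducer.run_eq_flatMap h,
      List.flatMap_append, N.toTransducer.weight_eq_length_mul h]
    congr 1
    simp only [Transducer.run, List.append_nil, List.flatMap_cons, List.flatMap_nil]
    congr 1
    exact Transducer.ofNat_congr (by simp [Nat.ModEq])
  refine ⟨fun c' hc' => ?_, fun hc => ?_, ?_⟩
  · obtain ⟨q', hq', rfl⟩ := Option.map_eq_some_iff.1 hc'
    have hL := flatMap_numImage (N.dir c.1) .left (num .left q' : Sym Q k) c.2.1
      (fun i => Fin.ofNat k (i * N.toTransducer.wt (num .left c.1)))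
      (fun h i => by simp [toTransducer, h])
    have hR := flatMap_numImage (N.dir c.1) .right (num .right q' : Sym Q k) c.2.2
      (fun i => Fin.ofNat k (c.2.1 * N.toTransducer.wt (num .left c.1) +
        i * N.toTransducer.wt (num .right c.1)))
      (fun h i => by simp [toTransducer, h])
    rw [Transducer.pass, hrun, word', word]
    simp only [List.flatMap_cons, List.flatMap_append, List.flatMap_map, List.flatMap_nil]
    have o1 : N.toTransducer.out (front' c.1) (Fin.ofNat k (N.readNum c.1 c.2.1 c.2.2)) =
        front q' :: if N.dir c.1 = some .right then
          List.replicate (N.digit c.1) (num .left q') else [] := by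
      simp only [toTransducer, hq', Option.elim_some]
    have o2 : ∀ d j, N.toTransducer.out (num' d c.1 j)
        (Fin.ofNat k (N.readNum c.1 c.2.1 c.2.2)) = numImage (N.dir c.1) d j (num d q') := by
      intro d j
      simp only [toTransducer, hq', Option.elim_some]
    have o3 : ∀ j, N.toTransducer.out (back' c.1 j) (Fin.ofNat k (N.readNum c.1 c.2.1 c.2.2)) =
        (if N.dir c.1 = some .left then List.replicate (N.digit c.1) (num .right q') else []) ++
          [back q'] := by
      intro j
      simp only [toTransducer, hq', Option.elim_some]
    simp only [o1, o2, o3, hL, hR]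
    rcases N.dir c.1 with _ | _ | _ <;>
      simp [update, ← List.append_assoc, List.replicate_append_replicate, Nat.add_comm]
  · have hn := Option.map_eq_none_iff.1 hc
    rw [Transducer.pass, hrun, List.mem_flatMap]
    refine ⟨back' c.1 (Fin.ofNat k (N.readNum c.1 c.2.1 c.2.2)), by simp [word'], ?_⟩
    simp only [toTransducer, hn, Option.elim_none, List.mem_singleton]
  · refine ((hg.trans (Nat.mod_modEq _ _).symm).add_right _).trans ?_
    rw [Nat.add_comm]
    exact N.weight_word' c

theorem halted_notMem_word' (c : Q × ℕ × ℕ) : halted ∉ N.word' c := by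
  simp [word']

theorem pass_two {c : Q × ℕ × ℕ} {s : List (Sym Q k) × ℕ} (h : s.1 = word c ∧ s.2 ≡ 0 [MOD k]) :
    (∀ c', N.step c = some c' → (N.toTransducer.pass^[2] s).1 = word c' ∧
      (N.toTransducer.pass^[2] s).2 ≡ 0 [MOD k]) ∧
    (N.step c = none → halted ∈ (N.toTransducer.pass^[2] s).1) ∧
    halted ∉ (N.toTransducer.pass s).1 := by
  obtain ⟨s, g⟩ := s
  obtain ⟨rfl, hg⟩ := h
  obtain ⟨h1, h2⟩ := N.pass_word c hg
  have e : N.toTransducer.pass (word c, g) =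
    (N.word' c, (N.toTransducer.pass (word c, g)).2) := Prod.ext h1 rfl
  obtain ⟨h3, h4, h5⟩ := N.pass_word' c h2
  rw [← e] at h3 h4 h5
  exact ⟨fun c' hc' => ⟨h3 c' hc', h5⟩, h4, h1 ▸ N.halted_notMem_word' c⟩

theorem exists_halted_mem_iff (c : Q × ℕ × ℕ) :
    (∃ i, halted ∈ (N.toTransducer.pass^[i] (word c, 0)).1) ↔
      (StateTransition.eval N.step c).Dom := by
  constructor
  · rintro ⟨i, hi⟩
    by_contra hdom
    -- Without halting, an even number of passes always yields the word of a configuration and an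
    -- odd number its intermediate word; neither contains `halted`.
    have key : ∀ n, ∃ c', StateTransition.Reaches N.step c c' ∧
        (N.toTransducer.pass^[2 * n] (word c, 0)).1 = word c' ∧
        (N.toTransducer.pass^[2 * n] (word c, 0)).2 ≡ 0 [MOD k] := by
      intro n
      induction n with
      | zero => exact ⟨c, Relation.ReflTransGen.refl, rfl, rfl⟩
      | succ n ih =>
        obtain ⟨c', hc', h⟩ := ih
        rcases hs : N.step c' with _ | c''
        · exact absurd (Part.dom_iff_mem.2 ⟨c', StateTransition.mem_eval.2 ⟨hc', hs⟩⟩) hdom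
        · rw [Nat.mul_succ, Nat.add_comm, Function.iterate_add_apply]
          exact ⟨c'', hc'.tail hs, (N.pass_two h).1 c'' hs⟩
    obtain ⟨c', -, h⟩ := key (i / 2)
    rcases Nat.mod_two_eq_zero_or_one i with hm | hm
    · rw [show i = 2 * (i / 2) by omega, h.1] at hi
      exact halted_notMem_word c' hi
    · rw [show i = 2 * (i / 2) + 1 by omega, Function.iterate_succ_apply'] at hi
      exact (N.pass_two h).2.2 hi
  · intro hdom
    obtain ⟨c', hc'⟩ := Part.dom_iff_mem.1 hdom
    obtain ⟨hr, hn⟩ := StateTransition.mem_eval.1 hc'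
    have : ∃ i, (N.toTransducer.pass^[i] (word c, 0)).1 = word c' ∧
        (N.toTransducer.pass^[i] (word c, 0)).2 ≡ 0 [MOD k] := by
      clear hn hc'
      induction hr with
      | refl => exact ⟨0, rfl, rfl⟩
      | tail _ hs ih =>
        obtain ⟨i, hi⟩ := ih
        refine ⟨2 + i, ?_⟩
        rw [Function.iterate_add_apply]
        exact (N.pass_two hi).1 _ hs
    obtain ⟨i, hi⟩ := this
    refine ⟨2 + i, ?_⟩
    rw [Function.iterate_add_apply]
    exact (N.pass_two hi).2.1 hn

theorem halted_mem_out (g : Fin k) : halted ∈ N.toTransducer.out halted g :=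
  List.mem_singleton_self _

instance [Finite Q] : Finite (Sym Q k) := by
  let f : Sym Q k → Fin 7 × Option Dir × Option Q × Option (Fin k)
    | front q => (0, none, some q, none)
    | num d q => (1, some d, some q, none)
    | back q => (2, none, some q, none)
    | front' q => (3, none, some q, none)
    | num' d q j => (4, some d, some q, some j)
    | back' q r => (5, none, some q, some r)
    | halted => (6, none, none, none)
  have : Finite Dir := Finite.of_injective (fun d : Dir => decide (d = .left)) (by
    rintro (_ | _) (_ | _) <;> simp)
  refine Finite.of_injective f ?_
  rintro (_ | _ | _ | _ | _ | _ | _) (_ | _ | _ | _ | _ | _ | _) h <;> simp_all [f]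

end NumMachine

/-! ### Turing machines as machines with two numbers -/

namespace NumMachine

open Turing (ListBlank TM0.Cfg TM0.Stmt)
open StateTransition (Respects Reaches₁)

section TuringMachine

set_option linter.unusedSectionVars false

variable {Γ Λ P : Type} [Inhabited Γ] [Inhabited Λ] {k : ℕ} [NeZero k]

/-- The base `k` digits of `n`, the lowest one first, are the symbols of the blank-padded list. -/
def IsNum (e : Γ ≃ Fin k) (l : ListBlank Γ) (n : ℕ) : Prop :=
  ∀ i, n / k ^ i % k = e (l.nth i)

variable {e : Γ ≃ Fin k} {l : ListBlank Γ} {n : ℕ}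

theorem IsNum.head (h : IsNum e l n) : e.symm (Fin.ofNat k n) = l.head := by
  rw [Equiv.symm_apply_eq]
  exact Fin.ext (by simpa using h 0)

theorem IsNum.tail (h : IsNum e l n) : IsNum e l.tail (n / k) := by
  intro i
  rw [← ListBlank.nth_succ, ← h, Nat.div_div_eq_div_mul, pow_succ']

theorem IsNum.cons (h : IsNum e l n) (a : Γ) : IsNum e (l.cons a) (k * n + e a) := by
  have hk := NeZero.pos k
  rintro (_ | i)
  · simp [Nat.mod_eq_of_lt (e a).2]
  · rw [ListBlank.nth_succ, ListBlank.tail_cons, ← h, pow_succ', ← Nat.div_div_eq_div_mul,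
      Nat.mul_add_div hk, Nat.div_eq_of_lt (e a).2, Nat.add_zero]

/-- The blank has digit 0, so the infinitely many blanks match the vanishing high digits. -/
theorem isNum_ofDigits (he : (e default : ℕ) = 0) (l : List Γ) :
    IsNum e (ListBlank.mk l) (Nat.ofDigits k (l.map fun a => (e a : ℕ))) := by
  induction l with
  | nil => intro i; simp [ListBlank.nth_mk, he]
  | cons a l ih =>
    have := ih.cons a
    rwa [ListBlank.cons_mk, Nat.add_comm] at this

variable (M : Turing.TM0.Machine Γ Λ) (e) (ι : P → Λ) (ρ : Λ → P) (p₀ : P)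

/-- The machine simulating a Turing machine with the set of states `P`: the two halves of the tape
are represented by numbers, the scanned symbol is part of the state. In the state `none` the
head is placed on the first symbol of the input. -/
def ofTM0 : NumMachine (Option (P × Γ)) k where
  dir
    | none => some .right
    | some (p, a) =>
      match M (ι p) a with
      | some (_, .move d) => some d
      | _ => none
  digit
    | none => 0
    | some (_, a) => e a
  next
    | none, r => some (some (p₀, e.symm r))
    | some (p, a), r =>
      match M (ι p) a with
      | some (q, .move _) => some (some (ρ q, e.symm r))
      | some (q, .write b) => some (some (ρ q, b))
      | none => none

/-- The correspondence of configurations. -/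
def CfgRel (c : TM0.Cfg Γ Λ) (c' : Option (P × Γ) × ℕ × ℕ) : Prop :=
  ∃ p L R, c' = (some (p, c.Tape.head), L, R) ∧ ι p = c.q ∧ IsNum e c.Tape.left L ∧
    IsNum e c.Tape.right R

theorem ofTM0_respects (h : ∀ p a q s, M (ι p) a = some (q, s) → ι (ρ q) = q) :
    Respects (Turing.TM0.step M) (ofTM0 e M ι ρ p₀).step (CfgRel e ι) := by
  rintro ⟨q, a, tL, tR⟩ _ ⟨p, L, R, rfl, rfl, hL, hR⟩
  dsimp only at hL hR
  rcases hM : M (ι p) a with _ | ⟨q', d | b⟩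
  · have e1 : Turing.TM0.step M ⟨ι p, a, tL, tR⟩ = none := by simp [Turing.TM0.step, hM]
    rw [e1]
    simp [step, ofTM0, hM]
  · have e1 : Turing.TM0.step M ⟨ι p, a, tL, tR⟩ = some ⟨q', Turing.Tape.move d ⟨a, tL, tR⟩⟩ := by
      simp [Turing.TM0.step, hM]
    rw [e1]
    rcases d with _ | _
    · refine ⟨(some (ρ q', tL.head), L / k, k * R + e a), ⟨ρ q', _, _, rfl, h _ _ _ _ hM, hL.tail,
        hR.cons a⟩, Relation.TransGen.single ?_⟩
      simp [step, ofTM0, hM, readNum, update, ← hL.head]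
    · refine ⟨(some (ρ q', tR.head), k * L + e a, R / k), ⟨ρ q', _, _, rfl, h _ _ _ _ hM,
        hL.cons a, hR.tail⟩, Relation.TransGen.single ?_⟩
      simp [step, ofTM0, hM, readNum, update, ← hR.head]
  · have e1 : Turing.TM0.step M ⟨ι p, a, tL, tR⟩ = some ⟨q', ⟨b, tL, tR⟩⟩ := by
      simp [Turing.TM0.step, hM, Turing.Tape.write]
    rw [e1]
    refine ⟨(some (ρ q', b), L, R), ⟨ρ q', _, _, rfl, h _ _ _ _ hM, hL, hR⟩,
      Relation.TransGen.single ?_⟩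
    simp [step, ofTM0, hM, update]

/-- One preliminary step pops the first input symbol into the state, so the whole input can be given
as a single number. -/
theorem ofTM0_eval_dom_iff (h : ∀ p a q s, M (ι p) a = some (q, s) → ι (ρ q) = q)
    (he : (e default : ℕ) = 0) (h₀ : ι p₀ = default) (l : List Γ) :
    (StateTransition.eval (ofTM0 e M ι ρ p₀).step
      (none, 0, Nat.ofDigits k (l.map fun a => (e a : ℕ)))).Dom ↔
    (StateTransition.eval (Turing.TM0.step M) (Turing.TM0.init l)).Dom := by
  have hl := isNum_ofDigits he l
  have h0 := isNum_ofDigits he []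
  have hstep : (ofTM0 e M ι ρ p₀).step (none, 0, Nat.ofDigits k (l.map fun a => (e a : ℕ))) =
      some (some (p₀, (ListBlank.mk l).head), 0,
        Nat.ofDigits k (l.map fun a => (e a : ℕ)) / k) := by
    simp [step, ofTM0, readNum, update, ← hl.head]
  rw [StateTransition.reaches_eval (Relation.ReflTransGen.single hstep)]
  exact StateTransition.tr_eval_dom (ofTM0_respects e M ι ρ p₀ h)
    ⟨p₀, _, _, rfl, h₀, h0, hl.tail⟩

end TuringMachine

/-- A Turing machine with finitely many symbols and states can be simulated by a machine that
keeps two numbers, the input being given as a number in base `k`. -/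
theorem exists_of_TM0 {Γ Λ : Type} [Inhabited Γ] [Finite Γ] [Inhabited Λ]
    (M : Turing.TM0.Machine Γ Λ) {S : Set Λ} (hS : S.Finite) (ss : Turing.TM0.Supports M S) :
    ∃ (Q : Type) (_ : Finite Q) (k : ℕ) (_ : NeZero k) (N : NumMachine Q k) (q₀ : Q) (d : Γ → ℕ),
      ∀ l : List Γ, (StateTransition.eval N.step (q₀, 0, Nat.ofDigits k (l.map d))).Dom ↔
        (StateTransition.eval (Turing.TM0.step M) (Turing.TM0.init l)).Dom := by
  classical
  have : Finite S := hS
  obtain ⟨k, ⟨e₁⟩⟩ := Finite.exists_equiv_fin Γ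
  have hk : NeZero k := ⟨by
    rintro rfl
    exact (e₁ default).elim0⟩
  -- The swap gives the blank the digit 0.
  let e : Γ ≃ Fin k := e₁.trans (Equiv.swap (e₁ default) 0)
  refine ⟨Option (S × Γ), inferInstance, k, hk,
    -- The fallback value is never used from a supported state, since `S` is closed under
    -- transitions.
    ofTM0 e M Subtype.val (fun q => if h : q ∈ S then ⟨q, h⟩ else ⟨default, ss.1⟩) ⟨default, ss.1⟩,
    none, fun a => e a, ofTM0_eval_dom_iff e M _ _ _ ?_ ?_ rfl⟩
  · intro p a q s h
    have : q ∈ S := ss.2 h p.2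
    simp [this]
  · simp [e]

end NumMachine

/-! ### A two-number machine with undecidable halting -/

section Universal

open Turing Turing.PartrecToTM2

/-- Every code of a partial recursive function on lists is run by a Turing machine. -/
theorem exists_TM0_of_code (c : ToPartrec.Code) :
    ∃ (Λ : Type) (_ : Inhabited Λ) (M : TM0.Machine (TM2to1.Γ' K' fun _ => Γ') Λ) (S : Finset Λ),
      TM0.Supports M (S : Set Λ) ∧ ∀ v : List ℕ,
        (StateTransition.eval (TM0.step M)
          (TM0.init (TM2to1.trInit K'.main (trList v)))).Dom ↔ (c.eval v).Dom := by
  -- Machines start in the default label, so the default is chosen to be the entry point of `c`.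
  let _ : Inhabited Λ' := ⟨trNormal c Cont'.halt⟩
  refine ⟨_, _, TM1to0.tr (TM2to1.tr PartrecToTM2.tr), _,
    TM1to0.tr_supports _ (TM2to1.tr_supports _ (PartrecToTM2.tr_supports c Cont'.halt)),
    fun v => ?_⟩
  have h1 := StateTransition.tr_eval_dom (TM1to0.tr_respects (TM2to1.tr PartrecToTM2.tr))
    (a₁ := TM1.init (TM2to1.trInit K'.main (trList v))) rfl
  have h2 := StateTransition.tr_eval_dom (TM2to1.tr_respects PartrecToTM2.tr)
    (TM2to1.trCfg_init K'.main (trList v))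
  have h3 : TM2.init K'.main (trList v) = init c v := by
    unfold TM2.init init
    congr 1
    funext k
    cases k <;> rfl
  rw [h3, PartrecToTM2.tr_eval] at h2
  exact h1.trans h2

theorem trNat_bit (b : Bool) (n : ℕ) (h : Nat.bit b n ≠ 0) :
    trNat (Nat.bit b n) = (bif b then Γ'.bit1 else Γ'.bit0) :: trNat n := by
  unfold trNat
  rw [← Num.ofNat'_eq, ← Num.ofNat'_eq, Num.ofNat'_bit]
  rcases hn : Num.ofNat' n with _ | p
  · cases b
    · have : n = 0 := by
        have h' := Num.to_of_nat n
        rw [← Num.ofNat'_eq, hn] at h'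
        exact h'.symm
      simp [this] at h
    · rfl
  · cases b <;> rfl

theorem trNat_eq_cons {n : ℕ} (h : n ≠ 0) :
    trNat n = (if n % 2 = 1 then Γ'.bit1 else Γ'.bit0) :: trNat (n / 2) := by
  have := trNat_bit n.bodd n.div2 (by rwa [Nat.bit_bodd_div2])
  rw [Nat.bit_bodd_div2, Nat.div2_val] at this
  rw [this, Nat.mod_two_of_bodd]
  cases n.bodd <;> rfl

/-- The number with the base `k` digits `d b`, where `b` runs through the binary digits of a
natural number in reverse order, is computable. -/
theorem computable_ofDigits_trNat (k : ℕ) (d : Γ' → ℕ) :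
    Computable fun n => Nat.ofDigits k ((trNat n).reverse.map d) := by
  -- Reversal makes the lowest bit the most significant digit; the second component is its place
  -- value, needed for the recursion from `n / 2` to `n`.
  let f : ℕ → ℕ × ℕ := fun n => (Nat.ofDigits k ((trNat n).reverse.map d), k ^ (trNat n).length)
  let D : ℕ → ℕ := fun n => d (if n % 2 = 1 then Γ'.bit1 else Γ'.bit0)
  have hf : ∀ n, n ≠ 0 → f n = ((f (n / 2)).1 + (f (n / 2)).2 * D n, k * (f (n / 2)).2) := by
    intro n hn
    simp only [f, D]
    rw [trNat_eq_cons hn]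
    simp [Nat.ofDigits_append, pow_succ']
  let g : Unit → List (ℕ × ℕ) → Option (ℕ × ℕ) := fun _ l =>
    if l.length = 0 then some (0, 1) else
      (l[l.length / 2]?).map fun p => (p.1 + p.2 * D l.length, k * p.2)
  have hD : Primrec D := by
    have : D = fun n => if n % 2 = 1 then d Γ'.bit1 else d Γ'.bit0 := by
      funext n
      exact apply_ite d _ _ _
    rw [this]
    exact Primrec.ite (Primrec.eq.comp (Primrec.nat_mod.comp .id (.const 2)) (.const 1))
      (.const _) (.const _)
  have hlen : Primrec fun p : Unit × List (ℕ × ℕ) => p.2.length :=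
    Primrec.list_length.comp .snd
  have hg : Primrec₂ g := by
    refine Primrec.ite (Primrec.eq.comp hlen (.const 0)) (.const _) ?_
    refine Primrec.option_map (Primrec.list_getElem?.comp .snd
      (Primrec.nat_div.comp hlen (.const 2))) ?_
    refine Primrec.pair (Primrec.nat_add.comp (Primrec.fst.comp .snd)
      (Primrec.nat_mul.comp (Primrec.snd.comp .snd) (hD.comp (hlen.comp .fst))))
      (Primrec.nat_mul.comp (.const k) (Primrec.snd.comp .snd))
  have key : Primrec₂ fun (_ : Unit) n => f n := by
    refine Primrec.nat_strong_rec _ hg fun _ n => ?_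
    rcases eq_or_ne n 0 with rfl | hn
    · simp [g, f]
    · have : n / 2 < n := by omega
      simp [g, hn, this, hf n hn]
  exact (Primrec.fst.comp (key.comp (.const ()) .id)).to_comp

/-- There is a machine with two numbers for which it is undecidable whether it halts. -/
theorem exists_numMachine_halting_undecidable :
    ∃ (Q : Type) (_ : Finite Q) (k : ℕ) (_ : NeZero k) (N : NumMachine Q k) (q₀ : Q) (r : ℕ → ℕ),
      Computable r ∧
        ¬ ComputablePred fun n => (StateTransition.eval N.step (q₀, 0, r n)).Dom := by
  -- A universal function: run the program numbered `n` on the input 0.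
  have hU : Partrec fun n => (Denumerable.ofNat Nat.Partrec.Code n).eval 0 :=
    Nat.Partrec.Code.eval_part.comp (Computable.ofNat _) (Computable.const 0)
  obtain ⟨c, hc⟩ := ToPartrec.Code.exists_code (Nat.Partrec'.part_iff₁.2 hU)
  obtain ⟨Λ, _, M, S, hS, hM⟩ := exists_TM0_of_code c
  have : Finite K' := Finite.of_injective
    (fun x : K' => (decide (x = .main), decide (x = .rev), decide (x = .aux))) (by
      rintro (_ | _ | _ | _) (_ | _ | _ | _) <;> simp)
  have : Finite (TM2to1.Γ' K' fun _ => Γ') :=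
    inferInstanceAs (Finite (Bool × ((k : K') → Option Γ')))
  obtain ⟨Q, hQ, k, hk, N, q₀, d, hN⟩ := NumMachine.exists_of_TM0 M S.finite_toSet hS
  refine ⟨Q, hQ, k, hk, N, q₀,
    fun n => Nat.ofDigits k ((TM2to1.trInit K'.main (trList [n])).map d), ?_, fun h => ?_⟩
  · let sym : Bool → Γ' → TM2to1.Γ' K' fun _ => Γ' :=
      fun b a => (b, Function.update (fun _ => none) K'.main (some a))
    -- The reversed input begins with the separator, which also carries the mark for the bottom of
    -- the stacks.
    have e : ∀ n, Nat.ofDigits k ((TM2to1.trInit K'.main (trList [n])).map d) =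
        d (sym true .cons) + k * Nat.ofDigits k ((trNat n).reverse.map (d ∘ sym false)) := by
      intro n
      simp only [TM2to1.trInit, trList, List.reverse_append, List.reverse_cons, List.reverse_nil,
        List.nil_append, List.singleton_append]
      change Nat.ofDigits k (d (sym true .cons) :: ((trNat n).reverse.map (sym false)).map d) = _
      rw [Nat.ofDigits_cons, List.map_map]
    simp only [e]
    exact Primrec.nat_add.to_comp.comp (.const _)
      (Primrec.nat_mul.to_comp.comp (.const k) (computable_ofDigits_trNat k _))
  · refine ComputablePred.halting_problem 0 (ComputablePred.computable_of_manyOneReducible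
      ⟨Encodable.encode, Computable.encode, fun a => ?_⟩ h)
    rw [hN, hM]
    have := hc ⟨[Encodable.encode a], rfl⟩
    simp only at this
    rw [this]
    simp [List.Vector.head, Part.map_Dom]

end Universal

/-! ### Computability of the reduction -/

namespace NumMachine

variable {Q : Type} {k : ℕ} [NeZero k] (N : NumMachine Q k)

open Transducer (Letter)

/-- The input for the decision problems that stands for the configuration `c` of the machine `N`,
the letters being numbered by `e`. -/
def toInput {m : ℕ} (e : Letter (Sym Q k) ≃ Fin m) (c : Q × ℕ × ℕ) : PD0LInput where
  size := m
  system := (N.toTransducer.toPD0L (word c)).relabel e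
  letter := e (some (some .halted))

variable {m : ℕ} (e : Letter (Sym Q k) ≃ Fin m) (c : Q × ℕ × ℕ)

theorem toInput_mem : N.toInput e c ∈
    {x : PD0LInput | x.system.NonErasing ∧ ∃ a, x.system.start = [a]} :=
  ⟨(N.toTransducer.toPD0L_nonErasing _).relabel _ e, e none, rfl⟩

theorem toInput_occurs_iff : (N.toInput e c).system.Occurs (N.toInput e c).letter ↔
    (StateTransition.eval N.step c).Dom := by
  rw [← exists_halted_mem_iff, ← Transducer.toPD0L_occurs_iff]
  exact PD0LSystem.relabel_occurs_iff _ e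

theorem toInput_occursInfinitelyOften_iff :
    (N.toInput e c).system.OccursInfinitelyOften (N.toInput e c).letter ↔
      (StateTransition.eval N.step c).Dom := by
  rw [← exists_halted_mem_iff,
    ← Transducer.toPD0L_occursInfinitelyOften_iff _ N.halted_mem_out]
  exact PD0LSystem.relabel_occursInfinitelyOften_iff _ e

/-- Only the images of the start letter depend on `n`, and they do so through `r n` copies of a
fixed word; every other entry of the code is constant. -/
theorem computable_code_toInput (q : Q) {r : ℕ → ℕ} (hr : Computable r) :
    Computable fun n => (N.toInput e (q, 0, r n)).code := by
  have hrep : ∀ w : List ℕ, Computable fun n => (List.replicate (r n) w).flatten := by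
    intro w
    have h := Computable.nat_rec (f := r) (g := fun _ => ([] : List ℕ))
      (h := fun _ p => w ++ p.2) hr (.const _)
      (Computable.list_append.comp (.const w) (Computable.snd.comp .snd))
    refine h.of_eq fun n => ?_
    induction r n with
    | zero => rfl
    | succ j ih => simpa [List.replicate_succ] using ih
  let enc : List (Sym Q k) → List ℕ := fun l => (N.toTransducer.encode l).map fun a => (e a : ℕ)
  have henc : Computable fun n => enc (word (q, 0, r n)) := by
    have h : ∀ n, enc (word (q, 0, r n)) = enc [.front q] ++
        ((List.replicate (r n) (enc [.num .right q])).flatten ++ enc [.back q]) := by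
      intro n
      have (j : ℕ) (x : Sym Q k) : enc (List.replicate j x) =
          (List.replicate j (enc [x])).flatten := by
        simp [enc, Transducer.encode, List.flatMap, List.map_flatten]
      rw [← this]
      simp [enc, word, Transducer.encode]
    simp only [h]
    exact Computable.list_append.comp (.const _)
      (Computable.list_append.comp (hrep _) (.const _))
  have hrow : ∀ (i : Fin k) (a : Fin m), Computable fun n =>
      ((N.toInput e (q, 0, r n)).system.morph i a).map Fin.val := by
    intro i a
    rcases ha : e.symm a with _ | _ | x
    · have h : ∀ n, ((N.toInput e (q, 0, r n)).system.morph i a).map Fin.val =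
          (e none : ℕ) :: enc (word (q, 0, r n)) := by
        intro n
        simp [toInput, PD0LSystem.relabel, Transducer.toPD0L, ha, enc]
      simp only [h]
      exact Computable.list_cons.comp (.const _) henc
    · refine (Computable.const
        (((N.toInput e (q, 0, 0)).system.morph i a).map Fin.val)).of_eq fun n => ?_
      simp only [toInput, PD0LSystem.relabel, Transducer.toPD0L, ha]
    · refine (Computable.const
        (((N.toInput e (q, 0, 0)).system.morph i a).map Fin.val)).of_eq fun n => ?_
      simp only [toInput, PD0LSystem.relabel, Transducer.toPD0L, ha]
  exact (Computable.const m).pair ((Computable.list_ofFn fun i =>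
    Computable.list_ofFn fun a => hrow i a).pair
      ((Computable.const [(e none : ℕ)]).pair (.const (e (some (some .halted)) : ℕ))))

end NumMachine

/-! ### Conclusion -/

/-- A decidable problem is decidable along every computable sequence of its inputs. -/
theorem DecidableProblem.computablePred {ι α : Type} [Primcodable α] {code : ι → α} {I : Set ι}
    {P : ι → Prop} (h : DecidableProblem code I P) {x : ℕ → ι} (hx : ∀ n, x n ∈ I)
    (hc : Computable fun n => code (x n)) : ComputablePred fun n => P (x n) := by
  obtain ⟨f, hf, h⟩ := h
  choose v hv hvP using fun n => h (x n) (hx n)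
  -- The partial decision procedure halts on each code in the sequence, so its composite with the
  -- sequence is total.
  have hcomp : Computable v :=
    (hf.comp hc).of_eq fun n => Part.eq_some_iff.2 (hv n)
  exact ComputablePred.computable_iff.2 ⟨v, hcomp, funext fun n => propext (hvP n).symm⟩

theorem mainTheorem4 :
    ¬ DecidableProblem PD0LInput.code
        {x | x.system.NonErasing ∧ ∃ a, x.system.start = [a]}
        (fun x => x.system.Occurs x.letter) ∧
    ¬ DecidableProblem PD0LInput.code
        {x | x.system.NonErasing ∧ ∃ a, x.system.start = [a]}
        (fun x => x.system.OccursInfinitelyOften x.letter) := by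
  obtain ⟨Q, _, k, _, N, q, r, hr, hN⟩ := exists_numMachine_halting_undecidable
  obtain ⟨m, ⟨e⟩⟩ := Finite.exists_equiv_fin (Transducer.Letter (NumMachine.Sym Q k))
  have hc := N.computable_code_toInput e q hr
  constructor
  · intro h
    have := h.computablePred (fun n => N.toInput_mem e (q, 0, r n)) hc
    simp only [NumMachine.toInput_occurs_iff] at this
    exact hN this
  · intro h
    have := h.computablePred (fun n => N.toInput_mem e (q, 0, r n)) hc
    simp only [NumMachine.toInput_occursInfinitelyOften_iff] at this
    exact hN this
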